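/- Let $g\ge 2$ and let $\Sigma$ be the hyperelliptic curve $y^2=P(x)$, where $P\in\mathbb C[x]$ is monic of degree $2g+1$ without multiple roots. Let $\mathfrak g$ be a classical Lie algebra of rank $l$: $\mathfrak{sl}(l+1)$, $\mathfrak{so}(2l+1)$, $\mathfrak{sp}(2l)$ (with $l\ge1$) or $\mathfrak{so}(2l)$ (with $l\ge 2$), and let $n=l+1,\,2l+1,\,2l,\,2l$, respectively, be the dimension of its standard representation. Let $d_1,\dots,d_l$ be the degrees of its basis invariants: $d_i=i+1$ for $\mathfrak{sl}(l+1)$, $d_i=2i$ for $\mathfrak{so}(2l+1)$ and $\mathfrak{sp}(2l)$, and $d_i=2i$ $(i<l)$, $d_l=l$ for $\mathfrak{so}(2l)$. For complex parameters (Hamiltonians) $H=(H^{(0)}_{ik},H^{(1)}_{is})$ put $$p_i(x,y,H)=\sum_{k=0}^{d_i(g-1)}H^{(0)}_{ik}x^k+\sum_{s=0}^{(d_i-1)(g-1)-2}H^{(1)}_{is}\,y\,x^s ,$$ and let $r_i=p_i$, except that $r_l=p_l^2$ for $\mathfrak{so}(2l)$. The spectral curve $C_H$ is the curve $$y^2=P(x),\qquad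 R(x,y,\lambda,H)=\lambda^n+\sum_{i=1}^l r_i(x,y,H)\lambda^{n-e_i}=0$$ in $\mathbb C^3$ (that is, away from infinity), where $e_i=i+1$ for $\mathfrak{sl}(l+1)$ and $e_i=2i$ otherwise. Enumerate the Hamiltonians as $H_j$ and put $$\omega_j=\frac{\partial R/\partial H_j}{\partial R/\partial\lambda}\,\frac{dx}{y}.$$ Suppose that every singular point of $C_H$ is a node (an ordinary double point), and that no singular point of $C_H$ and no ramification point of $C_H\to\Sigma$ lies over a finite branch point of $\Sigma\to\mathbb{CP}^1$ (that is, $y\neq0$ at all these points). 1. Every $\omega_j$ is holomorphic at every nonsingular point of $C_H$. 2. Suppose in addition that the nodes of $C_H$ persist in the family of spectral curves, i.e. for every singular point $p$ of $C_H$ and every neighbourhood $U$ of $p$, the curve $C_{H'}$ has a singular point in $U$ for all $H'$ sufficiently close to $H$. Then the pull-back of every $\omega_j$ to the normalization of $C_H$ is holomorphic. -/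

import Mathlib

open scoped ContDiff Manifold Topology

namespace HitchinHyperelliptic

/-- The four series of classical Lie algebras:
`A` is `sl(l+1)`, `B` is `so(2l+1)`, `C` is `sp(2l)`, `D` is `so(2l)`. -/
inductive ClassicalSeries where
  | A | B | C | D

/-- Smallest rank considered (`so(4)`, of type `D` and rank 2, is admitted). -/
def ClassicalSeries.minRank : ClassicalSeries → ℕ
  | .A => 1
  | .B => 1
  | .C => 1
  | .D => 2

/-- Dimension `n` of the standard representation for rank `l`. -/
def ClassicalSeries.repDim : ClassicalSeries → ℕ → ℕ
  | .A, l => l + 1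
  | .B, l => 2 * l + 1
  | .C, l => 2 * l
  | .D, l => 2 * l

/-- Degree of the coefficient `r_i` of the characteristic polynomial: `r_i` multiplies
`λ ^ (n - degree)`.  The index `i : Fin l` is zero-based. -/
def ClassicalSeries.coeffDegree : ClassicalSeries → (l : ℕ) → Fin l → ℕ
  | .A, _, i => i + 2
  | .B, _, i => 2 * (i + 1)
  | .C, _, i => 2 * (i + 1)
  | .D, _, i => 2 * (i + 1)

/-- Degree `d_i` of the `i`-th basis invariant.  For the series `D` the last basis invariant is the
Pfaffian, of degree `l`. -/
def ClassicalSeries.invDegree : ClassicalSeries → (l : ℕ) → Fin l → ℕ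
  | .A, _, i => i + 2
  | .B, _, i => 2 * (i + 1)
  | .C, _, i => 2 * (i + 1)
  | .D, l, i => if (i : ℕ) + 1 = l then l else 2 * (i + 1)

/-- Labels of the Hamiltonians: `⟨i, inl k⟩` is `H⁽⁰⁾_{ik}` with `0 ≤ k ≤ d_i (g - 1)`, and
`⟨i, inr s⟩` is `H⁽¹⁾_{is}` with `0 ≤ s ≤ (d_i - 1) (g - 1) - 2`
(no `s` at all if this bound is `-1`). -/
abbrev HamIndex (T : ClassicalSeries) (l g : ℕ) : Type :=
  (i : Fin l) ×
    (Fin (T.invDegree l i * (g - 1) + 1) ⊕ Fin ((T.invDegree l i - 1) * (g - 1) - 1))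

variable {T : ClassicalSeries} {l g : ℕ}

/-- The basis invariant `p_i = ∑ₖ H⁽⁰⁾_{ik} x ^ k + ∑ₛ H⁽¹⁾_{is} y x ^ s`. -/
noncomputable def basisInvariant (H : HamIndex T l g → ℂ) (i : Fin l) (x y : ℂ) : ℂ :=
  (∑ k : Fin (T.invDegree l i * (g - 1) + 1), H ⟨i, Sum.inl k⟩ * x ^ (k : ℕ)) +
    ∑ s : Fin ((T.invDegree l i - 1) * (g - 1) - 1), H ⟨i, Sum.inr s⟩ * (y * x ^ (s : ℕ))

/-- The coefficient `r_i` of the spectral equation: the basis invariant itself, except that for the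
series `D` the last coefficient is the square of the Pfaffian. -/
noncomputable def spectralCoeff : {T : ClassicalSeries} → (H : HamIndex T l g → ℂ) → Fin l →
    ℂ → ℂ → ℂ
  | .A, H, i, x, y => basisInvariant H i x y
  | .B, H, i, x, y => basisInvariant H i x y
  | .C, H, i, x, y => basisInvariant H i x y
  | .D, H, i, x, y =>
      if (i : ℕ) + 1 = l then basisInvariant H i x y ^ 2 else basisInvariant H i x y

/-- `R(x, y, λ, H) = λ ^ n + ∑ᵢ r_i(x, y, H) λ ^ (n - deg r_i)`, as a function of the point
`p = (x, y, λ)`. -/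
noncomputable def spectralR (H : HamIndex T l g → ℂ) (p : ℂ × ℂ × ℂ) : ℂ :=
  p.2.2 ^ T.repDim l +
    ∑ i : Fin l, spectralCoeff H i p.1 p.2.1 * p.2.2 ^ (T.repDim l - T.coeffDegree l i)

/-- `∂R/∂λ` at the point `p`. -/
noncomputable def dRdLambda (H : HamIndex T l g → ℂ) (p : ℂ × ℂ × ℂ) : ℂ :=
  deriv (fun t : ℂ => spectralR H (p.1, p.2.1, t)) p.2.2

open Classical in
/-- `∂R/∂H_j` at the point `p`. -/
noncomputable def dRdH (H : HamIndex T l g → ℂ) (j : HamIndex T l g) (p : ℂ × ℂ × ℂ) : ℂ :=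
  deriv (fun t : ℂ => spectralR (Function.update H j t) p) (H j)

/-- The function `y² - P(x)`, whose zero set is the cylinder over the base curve. -/
noncomputable def baseEq (P : Polynomial ℂ) (p : ℂ × ℂ × ℂ) : ℂ :=
  p.2.1 ^ 2 - P.eval p.1

/-- The finite part of the spectral curve, in the space of triples `(x, y, λ)`. -/
def spectralCurve (P : Polynomial ℂ) (H : HamIndex T l g → ℂ) : Set (ℂ × ℂ × ℂ) :=
  {p | baseEq P p = 0 ∧ spectralR H p = 0}

/-- Singular points, by the Jacobian criterion: the differentials of the two defining equations
are linearly dependent. -/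
def singularLocus (P : Polynomial ℂ) (H : HamIndex T l g → ℂ) : Set (ℂ × ℂ × ℂ) :=
  {p | p ∈ spectralCurve P H ∧
    ¬ LinearIndependent ℂ ![fderiv ℂ (baseEq P) p, fderiv ℂ (spectralR H) p]}

/-- Finite ramification points of the spectral curve over the base curve: the nonsingular points
at which the tangent line is in the `λ` direction. -/
def ramificationLocus (P : Polynomial ℂ) (H : HamIndex T l g → ℂ) : Set (ℂ × ℂ × ℂ) :=
  {p | p ∈ spectralCurve P H ∧ p ∉ singularLocus P H ∧ dRdLambda H p = 0}

/-- The spectral curve has a node (ordinary double point) at `p`: on the smooth surface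
`y² = P(x)`, near `p`, the equation `R` is a product of two holomorphic functions which vanish at
`p` and whose differentials there are linearly independent on the tangent plane of the surface. -/
def IsNode (P : Polynomial ℂ) (H : HamIndex T l g → ℂ) (p : ℂ × ℂ × ℂ) : Prop :=
  p ∈ spectralCurve P H ∧
    ∃ g₁ g₂ : ℂ × ℂ × ℂ → ℂ,
      AnalyticAt ℂ g₁ p ∧ AnalyticAt ℂ g₂ p ∧ g₁ p = 0 ∧ g₂ p = 0 ∧
      (∀ᶠ q in 𝓝 p, baseEq P q = 0 → spectralR H q = g₁ q * g₂ q) ∧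
      LinearIndependent ℂ ![fderiv ℂ (baseEq P) p, fderiv ℂ g₁ p, fderiv ℂ g₂ p]

/-- A singular point `p` of the spectral curve with Hamiltonians `H` persists in the family of
spectral curves: every neighbourhood of `p` contains a singular point of each spectral curve whose
Hamiltonians are close enough to `H`. -/
def SingularityPersists (P : Polynomial ℂ) (H : HamIndex T l g → ℂ) (p : ℂ × ℂ × ℂ) : Prop :=
  ∀ U ∈ 𝓝 p, ∀ᶠ H' in 𝓝 H, ∃ q ∈ U, q ∈ singularLocus P H'

/-- The pull-back along the holomorphic map `γ` of the angle differential
`ω_j = (∂R/∂H_j) / (∂R/∂λ) · dx / y` is holomorphic at `t₀`: its coefficient at `dt` has nonvanishing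
denominators in a punctured neighbourhood of `t₀`, and extends from there holomorphically
to `t₀`. -/
def AnglePullbackHolomorphicAt (H : HamIndex T l g → ℂ) (j : HamIndex T l g)
    (γ : ℂ → ℂ × ℂ × ℂ) (t₀ : ℂ) : Prop :=
  ∃ f : ℂ → ℂ, AnalyticAt ℂ f t₀ ∧
    ∀ᶠ t in 𝓝[≠] t₀,
      (γ t).2.1 ≠ 0 ∧ dRdLambda H (γ t) ≠ 0 ∧
      f t = dRdH H j (γ t) / dRdLambda H (γ t) * (deriv (fun s => (γ s).1) t / (γ t).2.1)

/-- `γ` is a local holomorphic parametrization of the curve `C`, centred at its point `p`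
(used at nonsingular points only). -/
def IsLocalParametrization (C : Set (ℂ × ℂ × ℂ)) (p : ℂ × ℂ × ℂ) (γ : ℂ → ℂ × ℂ × ℂ) : Prop :=
  AnalyticAt ℂ γ 0 ∧ γ 0 = p ∧ deriv γ 0 ≠ 0 ∧ ∀ᶠ t in 𝓝 (0 : ℂ), γ t ∈ C

/-- `ω_j` is holomorphic at the nonsingular point `p` of the spectral curve. -/
def AngleHolomorphicAt (P : Polynomial ℂ) (H : HamIndex T l g → ℂ) (j : HamIndex T l g)
    (p : ℂ × ℂ × ℂ) : Prop :=
  ∀ γ : ℂ → ℂ × ℂ × ℂ, IsLocalParametrization (spectralCurve P H) p γ →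
    AnglePullbackHolomorphicAt H j γ 0

/-- `ν : M → C` is a normalization of the closed analytic curve `C` with singular locus `S`:
`M` is a (possibly disconnected) Riemann surface and `ν` is a finite (proper with finite fibres)
holomorphic surjection onto `C`, biholomorphic over the nonsingular points (there a bijective
immersion), the preimage of which is dense. -/
structure IsNormalization {M : Type*} [TopologicalSpace M] [ChartedSpace ℂ M]
    (C S : Set (ℂ × ℂ × ℂ)) (ν : M → ℂ × ℂ × ℂ) : Prop where
  t2 : T2Space M
  isManifold : IsManifold 𝓘(ℂ, ℂ) ω M
  holomorphic : ContMDiff 𝓘(ℂ, ℂ) 𝓘(ℂ, ℂ × ℂ × ℂ) ω ν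
  range_eq : Set.range ν = C
  proper : IsProperMap ν
  finite_fibre : ∀ p, (ν ⁻¹' {p}).Finite
  dense_preimage : Dense (ν ⁻¹' (C \ S))
  injOn : Set.InjOn ν (ν ⁻¹' (C \ S))
  immersion : ∀ m ∈ ν ⁻¹' (C \ S),
    Function.Injective (mfderiv 𝓘(ℂ, ℂ) 𝓘(ℂ, ℂ × ℂ × ℂ) ν m)

end HitchinHyperelliptic

namespace HitchinHyperelliptic

/-! ### Analyticity of `R` and its dependence on the Hamiltonians -/

variable {T : ClassicalSeries} {l g : ℕ}

/-! Everything is tested along a nonconstant holomorphic curve `γ` in the spectral curve. Where `y ≠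
0`, the surface `y² = P(x)` has the tangent frame `X = ∂x + P'/(2y) ∂y`, `V = ∂λ`. If `G` vanishes
along `γ`, then `x' G_X + λ' G_V = 0`; when `G_X` and `G_V` are not both zero at the point, `dx /
G_V` is holomorphic (`exists_deriv_fst_eq_mul`). With `G = R` this settles nonsingular points having
`y ≠ 0`. Where `y = 0` there is no ramification, so `R_λ ≠ 0`, and `dx / y = 2 dy / P'(x)` is
regular because the roots of `P` are simple.

At a node `R = g₁ g₂` on the surface, and `γ` runs in one branch, say `g₁ = 0`. There `R_λ = (g₁)_λ
g₂`, so `ω_j` is the product of `dx / (g₁)_λ`, holomorphic as before, of `1 / y`, and of `(∂R/∂H_j)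
/ g₂`. The last factor is regular as soon as `∂R/∂H_j` vanishes at the node, since `g₂` has the
least possible order of vanishing along a branch transversal to `g₂ = 0`
(`anglePullbackHolomorphicAt_branch`).

Persistence supplies that vanishing (`dRdH_eq_zero_of_singularityPersists`). Moving `H_j` by `s`
turns `R` into `R + s ∂R/∂H_j + s² h'`. At a nearby singular point of the deformed curve the
derivative equations force `g₁, g₂ = O(s)`, so `g₁ g₂ = O(s²)`; dividing the deformed equation by
`s` and letting `s → 0` gives `∂R/∂H_j = 0` at the node. -/

theorem analyticAt_snd_fst (p : ℂ × ℂ × ℂ) : AnalyticAt ℂ (fun q : ℂ × ℂ × ℂ => q.2.1) p :=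
  ((ContinuousLinearMap.fst ℂ ℂ ℂ).comp (ContinuousLinearMap.snd ℂ ℂ (ℂ × ℂ))).analyticAt p

theorem analyticAt_snd_snd (p : ℂ × ℂ × ℂ) : AnalyticAt ℂ (fun q : ℂ × ℂ × ℂ => q.2.2) p :=
  ((ContinuousLinearMap.snd ℂ ℂ ℂ).comp (ContinuousLinearMap.snd ℂ ℂ (ℂ × ℂ))).analyticAt p

theorem analyticAt_basisInvariant (H : HamIndex T l g → ℂ) (i : Fin l) (p : ℂ × ℂ × ℂ) :
    AnalyticAt ℂ (fun q : ℂ × ℂ × ℂ => basisInvariant H i q.1 q.2.1) p := by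
  unfold basisInvariant
  exact AnalyticAt.add
    (Finset.analyticAt_fun_sum _ fun k _ => analyticAt_const.fun_mul (analyticAt_fst.fun_pow _))
    (Finset.analyticAt_fun_sum _ fun k _ =>
      analyticAt_const.fun_mul ((analyticAt_snd_fst p).fun_mul (analyticAt_fst.fun_pow _)))

theorem analyticAt_spectralCoeff (H : HamIndex T l g → ℂ) (i : Fin l) (p : ℂ × ℂ × ℂ) :
    AnalyticAt ℂ (fun q : ℂ × ℂ × ℂ => spectralCoeff H i q.1 q.2.1) p := by
  have h := analyticAt_basisInvariant H i p
  cases T with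
  | A => exact h
  | B => exact h
  | C => exact h
  | D =>
    simp only [spectralCoeff]
    split_ifs
    · exact h.fun_pow 2
    · exact h

theorem analyticAt_spectralR (H : HamIndex T l g → ℂ) (p : ℂ × ℂ × ℂ) :
    AnalyticAt ℂ (spectralR H) p := by
  unfold spectralR
  refine AnalyticAt.add ((analyticAt_snd_snd p).fun_pow _) (Finset.analyticAt_fun_sum _ fun i _ => ?_)
  exact (analyticAt_spectralCoeff H i p).fun_mul ((analyticAt_snd_snd p).fun_pow _)

theorem hasFDerivAt_baseEq (P : Polynomial ℂ) (p : ℂ × ℂ × ℂ) :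
    HasFDerivAt (baseEq P)
      ((2 * p.2.1) • ((ContinuousLinearMap.fst ℂ ℂ ℂ).comp (ContinuousLinearMap.snd ℂ ℂ (ℂ × ℂ))) -
        P.derivative.eval p.1 • ContinuousLinearMap.fst ℂ ℂ (ℂ × ℂ)) p := by
  have h1 : HasFDerivAt (fun q : ℂ × ℂ × ℂ => q.2.1)
      ((ContinuousLinearMap.fst ℂ ℂ ℂ).comp (ContinuousLinearMap.snd ℂ ℂ (ℂ × ℂ))) p :=
    ((ContinuousLinearMap.fst ℂ ℂ ℂ).comp (ContinuousLinearMap.snd ℂ ℂ (ℂ × ℂ))).hasFDerivAt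
  have h2 : HasFDerivAt (fun q : ℂ × ℂ × ℂ => q.1) (ContinuousLinearMap.fst ℂ ℂ (ℂ × ℂ)) p :=
    (ContinuousLinearMap.fst ℂ ℂ (ℂ × ℂ)).hasFDerivAt
  have h3 := (P.hasDerivAt p.1).comp_hasFDerivAt p h2
  have h4 := (h1.pow 2).sub h3
  exact h4.congr_fderiv (by simp)

theorem fderiv_baseEq_apply (P : Polynomial ℂ) (p v : ℂ × ℂ × ℂ) :
    fderiv ℂ (baseEq P) p v = 2 * p.2.1 * v.2.1 - P.derivative.eval p.1 * v.1 := by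
  rw [(hasFDerivAt_baseEq P p).fderiv]
  simp

theorem dRdLambda_eq_fderiv (H : HamIndex T l g → ℂ) (p : ℂ × ℂ × ℂ) :
    dRdLambda H p = fderiv ℂ (spectralR H) p (0, 0, 1) := by
  have h : HasDerivAt (fun t : ℂ => ((p.1, p.2.1, t) : ℂ × ℂ × ℂ)) (0, 0, 1) p.2.2 :=
    (hasDerivAt_const _ _).prodMk ((hasDerivAt_const _ _).prodMk (hasDerivAt_id _))
  exact ((analyticAt_spectralR H p).differentiableAt.hasFDerivAt.comp_hasDerivAt p.2.2 h).deriv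

theorem basisInvariant_update [DecidableEq (HamIndex T l g)] (H : HamIndex T l g → ℂ)
    (j : HamIndex T l g) (i : Fin l) :
    ∃ c : ℂ × ℂ × ℂ → ℂ, (∀ p, AnalyticAt ℂ c p) ∧ ∀ (s : ℂ) (p : ℂ × ℂ × ℂ),
      basisInvariant (Function.update H j (H j + s)) i p.1 p.2.1 =
        basisInvariant H i p.1 p.2.1 + s * c p := by
  -- A basis invariant is linear in `H`, so its increment is its value at the unit vector of `H_j`.
  refine ⟨fun p => basisInvariant (Pi.single j 1) i p.1 p.2.1,
    fun p => analyticAt_basisInvariant _ i p, fun s p => ?_⟩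
  have h : Function.update H j (H j + s) = 
      fun k => H k + s * (Pi.single j 1 : HamIndex T l g → ℂ) k := by
    funext k
    by_cases hk : k = j
    · subst hk; simp
    · simp [hk]
  simp only [h, basisInvariant, add_mul, Finset.sum_add_distrib, mul_add, Finset.mul_sum, mul_assoc]
  ring

/-- The term in `s²` is needed only for the squared Pfaffian of series `D`; every other coefficient
is affine in `H_j`. -/
theorem spectralCoeff_update [DecidableEq (HamIndex T l g)] (H : HamIndex T l g → ℂ)
    (j : HamIndex T l g) (i : Fin l) :
    ∃ c c' : ℂ × ℂ × ℂ → ℂ, (∀ p, AnalyticAt ℂ c p) ∧ (∀ p, AnalyticAt ℂ c' p) ∧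
      ∀ (s : ℂ) (p : ℂ × ℂ × ℂ), spectralCoeff (Function.update H j (H j + s)) i p.1 p.2.1 =
        spectralCoeff H i p.1 p.2.1 + s * c p + s ^ 2 * c' p := by
  obtain ⟨c, hc, h⟩ := basisInvariant_update H j i
  have hlin : ∃ b b' : ℂ × ℂ × ℂ → ℂ, (∀ p, AnalyticAt ℂ b p) ∧ (∀ p, AnalyticAt ℂ b' p) ∧
      ∀ (s : ℂ) (p : ℂ × ℂ × ℂ), basisInvariant (Function.update H j (H j + s)) i p.1 p.2.1 =
        basisInvariant H i p.1 p.2.1 + s * b p + s ^ 2 * b' p :=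
    ⟨c, fun _ => 0, hc, fun _ => analyticAt_const, fun s p => by rw [h]; ring⟩
  cases T with
  | A => exact hlin
  | B => exact hlin
  | C => exact hlin
  | D =>
    simp only [spectralCoeff]
    split_ifs
    · refine ⟨fun p => 2 * basisInvariant H i p.1 p.2.1 * c p, fun p => c p ^ 2, fun p => ?_,
        fun p => (hc p).fun_pow 2, fun s p => by rw [h]; ring⟩
      exact (analyticAt_const.fun_mul (analyticAt_basisInvariant H i p)).fun_mul (hc p)
    · exact hlin

theorem spectralR_update [DecidableEq (HamIndex T l g)] (H : HamIndex T l g → ℂ)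
    (j : HamIndex T l g) :
    ∃ h h' : ℂ × ℂ × ℂ → ℂ, (∀ p, AnalyticAt ℂ h p) ∧ (∀ p, AnalyticAt ℂ h' p) ∧
      ∀ (s : ℂ) (p : ℂ × ℂ × ℂ), spectralR (Function.update H j (H j + s)) p =
        spectralR H p + s * h p + s ^ 2 * h' p := by
  choose c c' hc hc' h using spectralCoeff_update H j
  refine ⟨fun p => ∑ i, c i p * p.2.2 ^ (T.repDim l - T.coeffDegree l i),
    fun p => ∑ i, c' i p * p.2.2 ^ (T.repDim l - T.coeffDegree l i), fun p => ?_, fun p => ?_,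
    fun s p => ?_⟩
  · exact Finset.analyticAt_fun_sum _ fun i _ => (hc i p).fun_mul ((analyticAt_snd_snd p).fun_pow _)
  · exact Finset.analyticAt_fun_sum _ fun i _ => (hc' i p).fun_mul ((analyticAt_snd_snd p).fun_pow _)
  · simp only [spectralR, h, add_mul, Finset.sum_add_distrib, Finset.mul_sum, mul_assoc]
    ring

open Classical in
/-- The spectral equation is polynomial of degree at most two in each Hamiltonian, with linear term
`∂R/∂H_j`. -/
theorem spectralR_update_eq_dRdH (H : HamIndex T l g → ℂ) (j : HamIndex T l g) :
    (∀ p, AnalyticAt ℂ (dRdH H j) p) ∧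
      ∃ h' : ℂ × ℂ × ℂ → ℂ, (∀ p, AnalyticAt ℂ h' p) ∧
        ∀ (s : ℂ) (p : ℂ × ℂ × ℂ), spectralR (Function.update H j (H j + s)) p =
          spectralR H p + s * dRdH H j p + s ^ 2 * h' p := by
  obtain ⟨h, h', hh, hh', hs⟩ := spectralR_update H j
  have key : dRdH H j = h := by
    funext p
    have e : (fun t : ℂ => spectralR (Function.update H j t) p) =
        fun t => spectralR H p + (t - H j) * h p + (t - H j) ^ 2 * h' p := by
      funext t
      rw [← hs, add_sub_cancel]
    have hd : HasDerivAt (fun t : ℂ => spectralR H p + (t - H j) * h p + (t - H j) ^ 2 * h' p)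
        (h p) (H j) := by
      have h1 : HasDerivAt (fun t : ℂ => t - H j) 1 (H j) := (hasDerivAt_id _).sub_const _
      have := ((h1.mul_const (h p)).const_add (spectralR H p)).add ((h1.pow 2).mul_const (h' p))
      exact this.congr_deriv (by simp)
    unfold dRdH
    rw [e]
    exact hd.deriv
  rw [key]
  exact ⟨hh, h', hh', hs⟩

/-- This makes the fibres of the spectral curve over the base finite. The polynomial is nonzero
because the lower terms cannot reach the exponent `n`: both `n` and the degrees are positive, so
even the truncated subtraction stays below `n`. -/
theorem exists_polynomial_eval_eq_spectralR (hl : T.minRank ≤ l) (H : HamIndex T l g → ℂ)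
    (x y : ℂ) : ∃ q : Polynomial ℂ, q ≠ 0 ∧ ∀ t, q.eval t = spectralR H (x, y, t) := by
  refine ⟨Polynomial.X ^ T.repDim l + ∑ i : Fin l, Polynomial.C (spectralCoeff H i x y) *
    Polynomial.X ^ (T.repDim l - T.coeffDegree l i), ?_, fun t => ?_⟩
  · intro h0
    have h1 := congrArg (fun q => q.coeff (T.repDim l)) h0
    have hne : ∀ i : Fin l, T.repDim l ≠ T.repDim l - T.coeffDegree l i := by
      intro i
      have := i.2
      cases T <;> simp only [ClassicalSeries.repDim, ClassicalSeries.coeffDegree] <;> omega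
    simp [Polynomial.finsetSum_coeff, Polynomial.coeff_X_pow, hne] at h1
  · simp [spectralR, Polynomial.eval_finsetSum]

/-! ### The tangent frame of the surface `y² = P(x)` -/

/-- The tangent vector of the surface `y² = P(x)` lifting `∂/∂x` and without `λ`-component. -/
noncomputable def horizontalVector (P : Polynomial ℂ) (q : ℂ × ℂ × ℂ) : ℂ × ℂ × ℂ :=
  (1, P.derivative.eval q.1 / (2 * q.2.1), 0)

/-- The tangent vector `∂/∂λ`. -/
def verticalVector : ℂ × ℂ × ℂ := (0, 0, 1)

theorem fderiv_baseEq_horizontalVector (P : Polynomial ℂ) {q : ℂ × ℂ × ℂ} (hy : q.2.1 ≠ 0) :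
    fderiv ℂ (baseEq P) q (horizontalVector P q) = 0 := by
  rw [fderiv_baseEq_apply, horizontalVector]
  field_simp
  ring

theorem fderiv_baseEq_verticalVector (P : Polynomial ℂ) (q : ℂ × ℂ × ℂ) :
    fderiv ℂ (baseEq P) q verticalVector = 0 := by
  simp [fderiv_baseEq_apply, verticalVector]

theorem eq_smul_horizontal_add_smul_vertical (P : Polynomial ℂ) {q v : ℂ × ℂ × ℂ} (hy : q.2.1 ≠ 0)
    (hv : fderiv ℂ (baseEq P) q v = 0) :
    v = v.1 • horizontalVector P q + v.2.2 • verticalVector := by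
  rw [fderiv_baseEq_apply] at hv
  refine Prod.ext ?_ (Prod.ext ?_ ?_) <;> simp only [horizontalVector, verticalVector,
    Prod.fst_add, Prod.snd_add, Prod.smul_fst, Prod.smul_snd, smul_eq_mul, mul_zero, mul_one,
    add_zero, zero_add]
  field_simp
  linear_combination hv

theorem analyticAt_horizontalVector (P : Polynomial ℂ) {q : ℂ × ℂ × ℂ} (hy : q.2.1 ≠ 0) :
    AnalyticAt ℂ (horizontalVector P) q := by
  have hP : AnalyticAt ℂ (fun r : ℂ × ℂ × ℂ => P.derivative.eval r.1) q :=
    (AnalyticOnNhd.eval_polynomial P.derivative q.1 trivial).comp analyticAt_fst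
  exact analyticAt_const.prod ((hP.fun_div (analyticAt_const.fun_mul (analyticAt_snd_fst q))
    (mul_ne_zero two_ne_zero hy)).prod analyticAt_const)

/-- Two independent covectors, one of them `d(y² - P)`: the other is nonzero on the surface. -/
theorem not_both_zero_of_linearIndependent (P : Polynomial ℂ) {q : ℂ × ℂ × ℂ} (hy : q.2.1 ≠ 0)
    {f : ℂ × ℂ × ℂ →L[ℂ] ℂ} (hf : LinearIndependent ℂ ![fderiv ℂ (baseEq P) q, f]) :
    f (horizontalVector P q) ≠ 0 ∨ f verticalVector ≠ 0 := by
  by_contra! h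
  -- Both covectors kill the tangent frame, so they are proportional; the ratio is read off on
  -- `∂/∂y`, where `d(y² - P)` equals `2y`.
  have key : f = (f (0, 1, 0) / (2 * q.2.1)) • fderiv ℂ (baseEq P) q := by
    refine ContinuousLinearMap.ext fun v => ?_
    have hv : v = v.1 • horizontalVector P q +
        (v.2.1 - v.1 * (P.derivative.eval q.1 / (2 * q.2.1))) • ((0, 1, 0) : ℂ × ℂ × ℂ) +
        v.2.2 • verticalVector := by
      refine Prod.ext ?_ (Prod.ext ?_ ?_) <;> simp [horizontalVector, verticalVector]
    conv_lhs => rw [hv]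
    simp only [map_add, map_smul, h.1, h.2, smul_apply, fderiv_baseEq_apply,
      smul_eq_mul]
    field_simp
    ring
  rw [LinearIndependent.pair_iff] at hf
  have := (hf (f (0, 1, 0) / (2 * q.2.1)) (-1) (by rw [← key]; simp)).2
  simp at this

/-- Three independent covectors span the dual of `ℂ³`, so all coordinates of `v` vanish. -/
theorem eq_zero_of_linearIndependent {f₁ f₂ f₃ : ℂ × ℂ × ℂ →L[ℂ] ℂ}
    (hf : LinearIndependent ℂ ![f₁, f₂, f₃]) {v : ℂ × ℂ × ℂ} (h₁ : f₁ v = 0) (h₂ : f₂ v = 0)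
    (h₃ : f₃ v = 0) : v = 0 := by
  have hfr : Module.finrank ℂ (ℂ × ℂ × ℂ →L[ℂ] ℂ) = 3 := by
    rw [← (LinearMap.toContinuousLinearMap (𝕜 := ℂ) (E := ℂ × ℂ × ℂ) (F' := ℂ)).finrank_eq,
      Module.finrank_linearMap]
    simp
  have hspan := hf.span_eq_top_of_card_eq_finrank (by simp [hfr])
  have hall : ∀ f : ℂ × ℂ × ℂ →L[ℂ] ℂ, f v = 0 := by
    intro f
    have hfm : f ∈ Submodule.span ℂ (Set.range ![f₁, f₂, f₃]) := hspan ▸ Submodule.mem_top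
    induction hfm using Submodule.span_induction with
    | mem x hx =>
      obtain ⟨i, rfl⟩ := hx
      fin_cases i <;> assumption
    | zero => simp
    | add x y _ _ hx hy => simp [hx, hy]
    | smul a x _ hx => simp [hx]
  refine Prod.ext (hall (.fst ℂ ℂ _)) (Prod.ext (hall ((ContinuousLinearMap.fst ℂ ℂ ℂ).comp
    (.snd ℂ ℂ _))) (hall ((ContinuousLinearMap.snd ℂ ℂ ℂ).comp (.snd ℂ ℂ _))))

/-- The Jacobian determinant, in the tangent frame of the surface, of two functions whose
differentials are independent on the surface. -/
theorem jacobian_ne_zero_of_linearIndependent (P : Polynomial ℂ) {q : ℂ × ℂ × ℂ} (hy : q.2.1 ≠ 0)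
    {f₁ f₂ : ℂ × ℂ × ℂ →L[ℂ] ℂ} (hf : LinearIndependent ℂ ![fderiv ℂ (baseEq P) q, f₁, f₂]) :
    f₂ (horizontalVector P q) * f₁ verticalVector -
      f₁ (horizontalVector P q) * f₂ verticalVector ≠ 0 := by
  intro hdet
  have hcomb : ∀ α β : ℂ,
      f₁ (α • horizontalVector P q + β • verticalVector) = 0 →
      f₂ (α • horizontalVector P q + β • verticalVector) = 0 → α = 0 ∧ β = 0 := by
    intro α β e₁ e₂
    have := eq_zero_of_linearIndependent hf (v := α • horizontalVector P q + β • verticalVector)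
      (by simp [fderiv_baseEq_horizontalVector P hy, fderiv_baseEq_verticalVector]) e₁ e₂
    exact ⟨by simpa [horizontalVector, verticalVector] using congrArg Prod.fst this,
      by simpa [horizontalVector, verticalVector] using congrArg (fun w => w.2.2) this⟩
  simp only [map_add, map_smul, smul_eq_mul] at hcomb
  -- With zero determinant, `f₁(V) X - f₁(X) V` is killed by both covectors, hence `f₁(X) = 0`.
  -- Likewise `f₂(X) = 0`, and then `X` itself would be killed by both.
  obtain ⟨h1, h2⟩ := hcomb (f₁ verticalVector) (-f₁ (horizontalVector P q)) (by ring)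
    (by linear_combination hdet)
  obtain ⟨h3, h4⟩ := hcomb (f₂ verticalVector) (-f₂ (horizontalVector P q))
    (by linear_combination -hdet) (by ring)
  rw [neg_eq_zero] at h2 h4
  simpa using (hcomb 1 0 (by simp [h2]) (by simp [h4])).1

/-- Functions which agree on the surface near one of its points have the same derivatives along the
surface there. -/
theorem fderiv_apply_eq_of_eqOn_surface (P : Polynomial ℂ) {F G : ℂ × ℂ × ℂ → ℂ}
    {q : ℂ × ℂ × ℂ} (hF : DifferentiableAt ℂ F q) (hG : DifferentiableAt ℂ G q)
    (hFG : ∀ᶠ r in 𝓝 q, baseEq P r = 0 → F r = G r) {φ : ℂ → ℂ × ℂ × ℂ} {v : ℂ × ℂ × ℂ}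
    (hφ : HasDerivAt φ v 0) (hφ0 : φ 0 = q) (hφB : ∀ᶠ s in 𝓝 0, baseEq P (φ s) = 0) :
    fderiv ℂ F q v = fderiv ℂ G q v := by
  subst hφ0
  have h1 := hF.hasFDerivAt.comp_hasDerivAt (0 : ℂ) hφ
  have h2 := hG.hasFDerivAt.comp_hasDerivAt (0 : ℂ) hφ
  refine h1.unique (h2.congr_of_eventuallyEq ?_)
  filter_upwards [hφB, hφ.continuousAt.eventually hFG] with s hs hs'
  exact hs' hs

theorem fderiv_verticalVector_eq_of_eqOn_surface (P : Polynomial ℂ) {F G : ℂ × ℂ × ℂ → ℂ}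
    {q : ℂ × ℂ × ℂ} (hF : DifferentiableAt ℂ F q) (hG : DifferentiableAt ℂ G q)
    (hFG : ∀ᶠ r in 𝓝 q, baseEq P r = 0 → F r = G r) (hq : baseEq P q = 0) :
    fderiv ℂ F q verticalVector = fderiv ℂ G q verticalVector := by
  refine fderiv_apply_eq_of_eqOn_surface P hF hG hFG
    (φ := fun s => (q.1, q.2.1, q.2.2 + s)) ?_ (by simp) (.of_forall fun s => hq)
  exact (hasDerivAt_const _ _).prodMk
    ((hasDerivAt_const _ _).prodMk ((hasDerivAt_id _).const_add _))

theorem fderiv_horizontalVector_eq_of_eqOn_surface (P : Polynomial ℂ) {F G : ℂ × ℂ × ℂ → ℂ}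
    {q : ℂ × ℂ × ℂ} (hF : DifferentiableAt ℂ F q) (hG : DifferentiableAt ℂ G q)
    (hFG : ∀ᶠ r in 𝓝 q, baseEq P r = 0 → F r = G r) (hq : baseEq P q = 0) (hy : q.2.1 ≠ 0) :
    fderiv ℂ F q (horizontalVector P q) = fderiv ℂ G q (horizontalVector P q) := by
  have hPq : P.eval q.1 = q.2.1 ^ 2 := (sub_eq_zero.mp hq).symm
  have h1 : HasDerivAt (fun s : ℂ => P.eval (q.1 + s) / q.2.1 ^ 2)
      (P.derivative.eval q.1 / q.2.1 ^ 2) 0 := by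
    have h := (P.hasDerivAt (q.1 + 0)).comp_const_add q.1 0
    simpa using h.div_const (q.2.1 ^ 2)
  have h10 : P.eval (q.1 + 0) / q.2.1 ^ 2 = 1 := by
    rw [add_zero, hPq, div_self (pow_ne_zero 2 hy)]
  -- A curve on the surface with velocity `X`: `y` is continued as `y₀ √(P(x₀ + s) / y₀²)`. The
  -- radicand is `1` at `s = 0`, where the principal root is holomorphic.
  have h2 : HasDerivAt (fun s : ℂ => q.2.1 * (P.eval (q.1 + s) / q.2.1 ^ 2) ^ (1 / 2 : ℂ))
      (P.derivative.eval q.1 / (2 * q.2.1)) 0 := by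
    have h := (h1.cpow_const (c := 1 / 2) (by rw [h10]; exact Complex.one_mem_slitPlane)).const_mul
      q.2.1
    refine h.congr_deriv ?_
    rw [h10, Complex.one_cpow]
    field_simp
  refine fderiv_apply_eq_of_eqOn_surface P hF hG hFG
    (φ := fun s => (q.1 + s, q.2.1 * (P.eval (q.1 + s) / q.2.1 ^ 2) ^ (1 / 2 : ℂ), q.2.2)) ?_ ?_
    (.of_forall fun s => ?_)
  · exact ((hasDerivAt_id _).const_add _).prodMk (h2.prodMk (hasDerivAt_const _ _))
  · simp only [h10, Complex.one_cpow, mul_one]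
    rw [add_zero]
  · have : ((P.eval (q.1 + s) / q.2.1 ^ 2) ^ (1 / 2 : ℂ)) ^ 2 = P.eval (q.1 + s) / q.2.1 ^ 2 := by
      rw [← Complex.cpow_nat_mul]
      norm_num
    simp only [baseEq, mul_pow, this]
    field_simp
    ring

/-! ### Holomorphic curves through nonsingular points -/

theorem eventually_eq_of_eventually_mem_finite {u : ℂ → ℂ} {t₀ : ℂ} (hu : ContinuousAt u t₀)
    {S : Set ℂ} (hS : S.Finite) (h : ∀ᶠ t in 𝓝 t₀, u t ∈ S) : ∀ᶠ t in 𝓝 t₀, u t = u t₀ := by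
  have hopen : (S \ {u t₀})ᶜ ∈ 𝓝 (u t₀) :=
    (hS.subset Set.sdiff_subset).isClosed.isOpen_compl.mem_nhds (by simp)
  filter_upwards [h, hu.eventually hopen] with t h1 h2
  by_contra h3
  exact h2 ⟨h1, h3⟩

theorem eventually_eq_of_eventually_deriv_eq_zero {u : ℂ → ℂ} {t₀ : ℂ} (hu : AnalyticAt ℂ u t₀)
    (h : ∀ᶠ t in 𝓝 t₀, deriv u t = 0) : ∀ᶠ t in 𝓝 t₀, u t = u t₀ := by
  obtain ⟨ε, hε, hb⟩ := Metric.eventually_nhds_iff_ball.mp (h.and hu.eventually_analyticAt)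
  filter_upwards [Metric.ball_mem_nhds t₀ hε] with t ht
  exact Metric.isOpen_ball.is_const_of_deriv_eq_zero (convex_ball t₀ ε).isPreconnected
    (fun s hs => (hb s hs).2.differentiableAt.differentiableWithinAt)
    (fun s hs => (hb s hs).1) ht (Metric.mem_ball_self hε)

theorem analyticAt_coords {γ : ℂ → ℂ × ℂ × ℂ} {t₀ : ℂ} (hγ : AnalyticAt ℂ γ t₀) :
    AnalyticAt ℂ (fun t => (γ t).1) t₀ ∧ AnalyticAt ℂ (fun t => (γ t).2.1) t₀ ∧
      AnalyticAt ℂ (fun t => (γ t).2.2) t₀ :=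
  ⟨analyticAt_fst.comp hγ, (analyticAt_snd_fst (γ t₀)).comp hγ, (analyticAt_snd_snd (γ t₀)).comp hγ⟩

theorem deriv_coords {γ : ℂ → ℂ × ℂ × ℂ} {t : ℂ} (hγ : DifferentiableAt ℂ γ t) :
    deriv (fun s => (γ s).1) t = (deriv γ t).1 ∧ deriv (fun s => (γ s).2.1) t = (deriv γ t).2.1 ∧
      deriv (fun s => (γ s).2.2) t = (deriv γ t).2.2 :=
  ⟨((ContinuousLinearMap.fst ℂ ℂ (ℂ × ℂ)).hasFDerivAt.comp_hasDerivAt t hγ.hasDerivAt).deriv,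
    (((ContinuousLinearMap.fst ℂ ℂ ℂ).comp
      (ContinuousLinearMap.snd ℂ ℂ (ℂ × ℂ))).hasFDerivAt.comp_hasDerivAt t hγ.hasDerivAt).deriv,
    (((ContinuousLinearMap.snd ℂ ℂ ℂ).comp
      (ContinuousLinearMap.snd ℂ ℂ (ℂ × ℂ))).hasFDerivAt.comp_hasDerivAt t hγ.hasDerivAt).deriv⟩

theorem analyticAt_baseEq (P : Polynomial ℂ) (p : ℂ × ℂ × ℂ) : AnalyticAt ℂ (baseEq P) p :=
  ((analyticAt_snd_fst p).fun_pow 2).sub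
    ((AnalyticOnNhd.eval_polynomial P p.1 trivial).comp analyticAt_fst)

theorem analyticAt_fderiv_apply {γ v : ℂ → ℂ × ℂ × ℂ} {t₀ : ℂ} (hγ : AnalyticAt ℂ γ t₀)
    {G : ℂ × ℂ × ℂ → ℂ} (hG : AnalyticAt ℂ G (γ t₀)) (hv : AnalyticAt ℂ v t₀) :
    AnalyticAt ℂ (fun t => fderiv ℂ G (γ t) (v t)) t₀ :=
  ((ContinuousLinearMap.id ℂ (ℂ × ℂ × ℂ →L[ℂ] ℂ)).analyticAt_bilinear
    (fderiv ℂ G (γ t₀), v t₀)).comp₂ (hG.fderiv.comp hγ) hv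

/-- A nonconstant holomorphic map to the spectral curve is not contained in a fibre of the
projection to the `x`-line. -/
theorem eventually_eq_of_eventually_deriv_fst_eq_zero (hl : T.minRank ≤ l) (P : Polynomial ℂ)
    (H : HamIndex T l g → ℂ) {γ : ℂ → ℂ × ℂ × ℂ} {t₀ : ℂ} (hγ : AnalyticAt ℂ γ t₀)
    (hC : ∀ᶠ t in 𝓝 t₀, γ t ∈ spectralCurve P H)
    (hx : ∀ᶠ t in 𝓝 t₀, deriv (fun s => (γ s).1) t = 0) : ∀ᶠ t in 𝓝 t₀, γ t = γ t₀ := by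
  obtain ⟨hax, hay, haz⟩ := analyticAt_coords hγ
  have hx' := eventually_eq_of_eventually_deriv_eq_zero hax hx
  have hy' : ∀ᶠ t in 𝓝 t₀, (γ t).2.1 = (γ t₀).2.1 := by
    have hq : (Polynomial.X ^ 2 - Polynomial.C (P.eval (γ t₀).1)) ≠ 0 :=
      Polynomial.X_pow_sub_C_ne_zero two_pos _
    refine eventually_eq_of_eventually_mem_finite hay.continuousAt
      (Polynomial.finite_setOfPred_isRoot hq) ?_
    filter_upwards [hC, hx'] with t h1 h2
    have h3 := h1.1
    simp only [baseEq, h2] at h3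
    simpa [Polynomial.IsRoot] using h3
  obtain ⟨q, hq, hqe⟩ := exists_polynomial_eval_eq_spectralR hl H (γ t₀).1 (γ t₀).2.1
  have hz' : ∀ᶠ t in 𝓝 t₀, (γ t).2.2 = (γ t₀).2.2 := by
    refine eventually_eq_of_eventually_mem_finite haz.continuousAt
      (Polynomial.finite_setOfPred_isRoot hq) ?_
    filter_upwards [hC, hx', hy'] with t h1 h2 h3
    change q.eval (γ t).2.2 = 0
    rw [hqe, ← h2, ← h3]
    exact h1.2
  filter_upwards [hx', hy', hz'] with t h1 h2 h3
  exact Prod.ext h1 (Prod.ext h2 h3)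

theorem eventually_fderiv_apply_deriv_eq_zero {γ : ℂ → ℂ × ℂ × ℂ} {t₀ : ℂ}
    (hγ : AnalyticAt ℂ γ t₀) {G : ℂ × ℂ × ℂ → ℂ} (hG : AnalyticAt ℂ G (γ t₀))
    (h0 : ∀ᶠ t in 𝓝 t₀, G (γ t) = 0) : ∀ᶠ t in 𝓝 t₀, fderiv ℂ G (γ t) (deriv γ t) = 0 := by
  filter_upwards [hγ.eventually_analyticAt, hγ.continuousAt.eventually hG.eventually_analyticAt,
    h0.eventually_nhds] with t h1 h2 h3
  have h4 := h2.differentiableAt.hasFDerivAt.comp_hasDerivAt t h1.differentiableAt.hasDerivAt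
  refine h4.unique ((hasDerivAt_const t (0 : ℂ)).congr_of_eventuallyEq ?_)
  exact h3

/-- On a curve `γ` in the surface `y² = P(x)` along which `G` vanishes, and at a point at which `G`
is a submersion of the surface, `dx / G_λ` is holomorphic. -/
theorem exists_deriv_fst_eq_mul (P : Polynomial ℂ) {γ : ℂ → ℂ × ℂ × ℂ} {t₀ : ℂ}
    (hγ : AnalyticAt ℂ γ t₀) (hB : ∀ᶠ t in 𝓝 t₀, baseEq P (γ t) = 0) (hy : (γ t₀).2.1 ≠ 0)
    {G : ℂ × ℂ × ℂ → ℂ} (hG : AnalyticAt ℂ G (γ t₀)) (hG0 : ∀ᶠ t in 𝓝 t₀, G (γ t) = 0)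
    (hsub : fderiv ℂ G (γ t₀) (horizontalVector P (γ t₀)) ≠ 0 ∨
      fderiv ℂ G (γ t₀) verticalVector ≠ 0)
    (hx : ¬ ∀ᶠ t in 𝓝 t₀, deriv (fun s => (γ s).1) t = 0) :
    ∃ f : ℂ → ℂ, AnalyticAt ℂ f t₀ ∧
      (∀ᶠ t in 𝓝[≠] t₀, fderiv ℂ G (γ t) verticalVector ≠ 0) ∧
      ∀ᶠ t in 𝓝 t₀, deriv (fun s => (γ s).1) t = f t * fderiv ℂ G (γ t) verticalVector := by
  obtain ⟨hax, hay, haz⟩ := analyticAt_coords hγ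
  have hw : AnalyticAt ℂ (fun t => fderiv ℂ G (γ t) verticalVector) t₀ :=
    analyticAt_fderiv_apply hγ hG analyticAt_const
  have hu : AnalyticAt ℂ (fun t => fderiv ℂ G (γ t) (horizontalVector P (γ t))) t₀ :=
    analyticAt_fderiv_apply hγ hG ((analyticAt_horizontalVector P hy).comp hγ)
  have key : ∀ᶠ t in 𝓝 t₀,
      deriv (fun s => (γ s).1) t * fderiv ℂ G (γ t) (horizontalVector P (γ t)) +
        deriv (fun s => (γ s).2.2) t * fderiv ℂ G (γ t) verticalVector = 0 := by
    filter_upwards [eventually_fderiv_apply_deriv_eq_zero hγ hG hG0,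
      eventually_fderiv_apply_deriv_eq_zero hγ (analyticAt_baseEq P _) hB, hγ.eventually_analyticAt,
      hay.continuousAt.eventually_ne hy] with t h1 h2 h3 h4
    obtain ⟨e1, -, e3⟩ := deriv_coords h3.differentiableAt
    rw [eq_smul_horizontal_add_smul_vertical P h4 h2, map_add, map_smul, map_smul] at h1
    rw [e1, e3]
    exact h1
  by_cases hw0 : fderiv ℂ G (γ t₀) verticalVector = 0
  · have hu0 := hsub.resolve_right (not_not.mpr hw0)
    have hune := hu.continuousAt.eventually_ne hu0
    refine ⟨fun t => -deriv (fun s => (γ s).2.2) t /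
      fderiv ℂ G (γ t) (horizontalVector P (γ t)), haz.deriv.fun_neg.fun_div hu hu0, ?_, ?_⟩
    -- If `G_V` vanished identically along `γ`, then `x' G_X = 0` with `G_X ≠ 0` would make `x`
    -- constant.
    · refine hw.eventually_eq_zero_or_eventually_ne_zero.resolve_left fun hz => hx ?_
      filter_upwards [key, hz, hune] with t h1 h2 h3
      rw [h2, mul_zero, add_zero] at h1
      exact (mul_eq_zero.mp h1).resolve_right h3
    · filter_upwards [key, hune] with t h1 h2
      field_simp
      linear_combination h1
  · have hwne := hw.continuousAt.eventually_ne hw0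
    refine ⟨fun t => deriv (fun s => (γ s).1) t / fderiv ℂ G (γ t) verticalVector,
      hax.deriv.fun_div hw hw0, hwne.filter_mono nhdsWithin_le_nhds, ?_⟩
    filter_upwards [hwne] with t h1
    field_simp

/-- Angle differentials pull back to holomorphic ones along nonconstant holomorphic maps to the
curve, where these pass through nonsingular points. -/
theorem anglePullbackHolomorphicAt_of_notMem_singularLocus (hl : T.minRank ≤ l)
    {P : Polynomial ℂ} (hPsq : Squarefree P) {H : HamIndex T l g → ℂ}
    (havoid : ∀ p ∈ ramificationLocus P H, p.2.1 ≠ 0)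
    (j : HamIndex T l g) {γ : ℂ → ℂ × ℂ × ℂ} {t₀ : ℂ} (hγ : AnalyticAt ℂ γ t₀)
    (hC : ∀ᶠ t in 𝓝 t₀, γ t ∈ spectralCurve P H) (hne : ¬ ∀ᶠ t in 𝓝 t₀, γ t = γ t₀)
    (hp : γ t₀ ∉ singularLocus P H) : AnglePullbackHolomorphicAt H j γ t₀ := by
  obtain ⟨hax, hay, haz⟩ := analyticAt_coords hγ
  have hpC := hC.self_of_nhds
  have hx := mt (eventually_eq_of_eventually_deriv_fst_eq_zero hl P H hγ hC) hne
  have hh : AnalyticAt ℂ (fun t => dRdH H j (γ t)) t₀ :=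
    ((spectralR_update_eq_dRdH H j).1 _).comp hγ
  by_cases hy : (γ t₀).2.1 = 0
  · have hR : dRdLambda H (γ t₀) ≠ 0 := fun h0 => havoid _ ⟨hpC, hp, h0⟩ hy
    have hRan : AnalyticAt ℂ (fun t => dRdLambda H (γ t)) t₀ := by
      simp only [dRdLambda_eq_fderiv]
      exact analyticAt_fderiv_apply hγ (analyticAt_spectralR H _) analyticAt_const
    have hP0 : P.derivative.eval (γ t₀).1 ≠ 0 := by
      have h0 : P.eval (γ t₀).1 = 0 := by
        have := hpC.1
        rw [baseEq, hy] at this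
        simpa using this
      have hsep : P.Separable := PerfectField.separable_iff_squarefree.mpr hPsq
      exact hsep.aeval_derivative_ne_zero h0
    have hPan : AnalyticAt ℂ (fun t => P.derivative.eval (γ t).1) t₀ :=
      AnalyticAt.comp (f := fun t => (γ t).1)
        (AnalyticOnNhd.eval_polynomial P.derivative (γ t₀).1 trivial) hax
    have hBd := eventually_fderiv_apply_deriv_eq_zero hγ (analyticAt_baseEq P _) (hC.mono fun t ht => ht.1)
    have hPne := hPan.continuousAt.eventually_ne hP0
    have hyne : ∀ᶠ t in 𝓝[≠] t₀, (γ t).2.1 ≠ 0 := by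
      refine hay.eventually_eq_zero_or_eventually_ne_zero.resolve_left fun hz => hx ?_
      filter_upwards [hBd, hz, hPne, hγ.eventually_analyticAt] with t h1 h2 h3 h4
      rw [fderiv_baseEq_apply, h2, ← (deriv_coords h4.differentiableAt).1] at h1
      simpa [h3] using h1
    -- Differentiating `y² = P(x)` along `γ` gives `2 y y' = P'(x) x'`, so `x' / y` is replaced by
    -- `2 y' / P'(x)`.
    refine ⟨fun t => dRdH H j (γ t) / dRdLambda H (γ t) *
      (2 * deriv (fun s => (γ s).2.1) t / P.derivative.eval (γ t).1),
      (hh.fun_div hRan hR).fun_mul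
        ((analyticAt_const.fun_mul hay.deriv).fun_div hPan hP0), ?_⟩
    filter_upwards [hyne, (hRan.continuousAt.eventually_ne hR).filter_mono nhdsWithin_le_nhds,
      hBd.filter_mono nhdsWithin_le_nhds, hPne.filter_mono nhdsWithin_le_nhds,
      hγ.eventually_analyticAt.filter_mono nhdsWithin_le_nhds] with t h1 h2 h3 h4 h5
    refine ⟨h1, h2, ?_⟩
    obtain ⟨e1, e2, -⟩ := deriv_coords h5.differentiableAt
    rw [fderiv_baseEq_apply, ← e1, ← e2] at h3
    congr 1
    field_simp
    linear_combination h3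
  · have hind : LinearIndependent ℂ
        ![fderiv ℂ (baseEq P) (γ t₀), fderiv ℂ (spectralR H) (γ t₀)] := by
      by_contra h
      exact hp ⟨hpC, h⟩
    obtain ⟨f, hf, hf1, hf2⟩ := exists_deriv_fst_eq_mul P hγ (hC.mono fun t ht => ht.1) hy
      (analyticAt_spectralR H _) (hC.mono fun t ht => ht.2)
      (not_both_zero_of_linearIndependent P hy hind) hx
    refine ⟨fun t => dRdH H j (γ t) * (f t / (γ t).2.1), hh.fun_mul (hf.fun_div hay hy), ?_⟩
    filter_upwards [hf1, hf2.filter_mono nhdsWithin_le_nhds,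
      (hay.continuousAt.eventually_ne hy).filter_mono nhdsWithin_le_nhds] with t h1 h2 h3
    rw [verticalVector, ← dRdLambda_eq_fderiv] at h1 h2
    refine ⟨h3, h1, ?_⟩
    rw [h2]
    field_simp

/-! ### Orders of vanishing and the branches of a node -/

open Asymptotics in
-- An order `m ≤ k` would make `(t - t₀)^m` negligible against itself. This absorbs the remainder of
-- the linearization of a function along a curve.
theorem exists_eq_pow_succ_mul_of_isLittleO {e : ℂ → ℂ} {t₀ : ℂ}
    (he : AnalyticAt ℂ e t₀) {k : ℕ} (ho : e =o[𝓝 t₀] fun t => (t - t₀) ^ k) :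
    ∃ F : ℂ → ℂ, AnalyticAt ℂ F t₀ ∧ ∀ᶠ t in 𝓝 t₀, e t = (t - t₀) ^ (k + 1) * F t := by
  have hle : ((k + 1 : ℕ) : ℕ∞) ≤ analyticOrderAt e t₀ := by
    by_contra! hlt
    obtain ⟨m, hm⟩ := ENat.ne_top_iff_exists.mp hlt.ne_top
    rw [← hm, Nat.cast_lt, Nat.lt_succ_iff] at hlt
    obtain ⟨G, hG, hG0, hGe⟩ := he.analyticOrderAt_eq_natCast.mp hm.symm
    have h1 : (fun t => (t - t₀) ^ k) =O[𝓝 t₀] fun t => (t - t₀) ^ m := by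
      obtain ⟨d, rfl⟩ := Nat.exists_eq_add_of_le hlt
      have hd : (fun t : ℂ => (t - t₀) ^ d) =O[𝓝 t₀] fun _ => (1 : ℂ) :=
        (show ContinuousAt (fun t : ℂ => (t - t₀) ^ d) t₀ by fun_prop).tendsto.isBigO_one _
      simpa [pow_add] using (isBigO_refl (fun t : ℂ => (t - t₀) ^ m) (𝓝 t₀)).mul hd
    have h2 : (fun t => (t - t₀) ^ m) =O[𝓝 t₀] e := by
      have hd : (fun t => (G t)⁻¹) =O[𝓝 t₀] fun _ => (1 : ℂ) :=
        (hG.continuousAt.inv₀ hG0).isBigO_one _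
      have h3 := (isBigO_refl e (𝓝 t₀)).mul hd
      simp only [mul_one] at h3
      refine h3.congr' ?_ .rfl
      filter_upwards [hGe, hG.continuousAt.eventually_ne hG0] with t h4 h5
      rw [h4, smul_eq_mul, mul_assoc, mul_inv_cancel₀ h5, mul_one]
    have h3 := (h2.trans_isLittleO ho).trans_isBigO h1
    refine isLittleO_irrefl' ?_ h3
    have h4 : ∃ᶠ t in 𝓝[≠] t₀, ‖(t - t₀) ^ m‖ ≠ 0 := by
      refine Filter.Eventually.frequently ?_
      filter_upwards [self_mem_nhdsWithin] with t ht
      exact norm_ne_zero_iff.mpr (pow_ne_zero _ (sub_ne_zero.mpr ht))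
    exact h4.filter_mono nhdsWithin_le_nhds
  exact (natCast_le_analyticOrderAt he).mp hle

open Asymptotics in
/-- The leading direction `v` of a nonconstant holomorphic curve, and the order `k` of its contact
with it: a function vanishing at the base point has order `k` along the curve, with leading
coefficient its derivative in the direction `v`, if this does not vanish. -/
theorem exists_leading_direction {γ : ℂ → ℂ × ℂ × ℂ} {t₀ : ℂ} (hγ : AnalyticAt ℂ γ t₀)
    (hne : ¬ ∀ᶠ t in 𝓝 t₀, γ t = γ t₀) :
    ∃ (k : ℕ) (v : ℂ × ℂ × ℂ), v ≠ 0 ∧ ∀ G : ℂ × ℂ × ℂ → ℂ, AnalyticAt ℂ G (γ t₀) →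
      G (γ t₀) = 0 → ∃ F : ℂ → ℂ, AnalyticAt ℂ F t₀ ∧ F t₀ = fderiv ℂ G (γ t₀) v ∧
        ∀ᶠ t in 𝓝 t₀, G (γ t) = (t - t₀) ^ k * F t := by
  have hsub : AnalyticAt ℂ (fun t => γ t - γ t₀) t₀ := hγ.sub analyticAt_const
  -- Factor `γ t - γ t₀ = (t - t₀)^k δ(t)` with `δ(t₀) ≠ 0`; the leading direction is `δ(t₀)`.
  obtain ⟨k, δ, hδ, hδ0, hδe⟩ := hsub.exists_eventuallyEq_pow_smul_nonzero_iff.mpr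
    (by simpa only [sub_eq_zero] using hne)
  refine ⟨k, δ t₀, hδ0, fun G hG hG0 => ?_⟩
  have hd : AnalyticAt ℂ (fun t => fderiv ℂ G (γ t₀) (δ t)) t₀ :=
    ((fderiv ℂ G (γ t₀)).analyticAt _).comp hδ
  have he : AnalyticAt ℂ
      (fun t => G (γ t) - (t - t₀) ^ k * fderiv ℂ G (γ t₀) (δ t)) t₀ :=
    (hG.comp hγ).sub (((analyticAt_id.sub analyticAt_const).fun_pow k).fun_mul hd)
  have ho : (fun t => G (γ t) - (t - t₀) ^ k * fderiv ℂ G (γ t₀) (δ t)) =o[𝓝 t₀]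
      fun t => (t - t₀) ^ k := by
    have h1 := hG.differentiableAt.hasFDerivAt.isLittleO.comp_tendsto hγ.continuousAt.tendsto
    have h2 : (fun t => γ t - γ t₀) =O[𝓝 t₀] fun t => (t - t₀) ^ k := by
      have h3 := (isBigO_refl (fun t : ℂ => (t - t₀) ^ k) (𝓝 t₀)).smul
        (hδ.continuousAt.isBigO_one ℂ)
      simp only [smul_eq_mul, mul_one] at h3
      exact h3.congr' (hδe.mono fun t ht => ht.symm) .rfl
    refine (h1.trans_isBigO h2).congr' ?_ .rfl
    filter_upwards [hδe] with t ht
    simp only [Function.comp_apply, ht, hG0, sub_zero, map_smul, smul_eq_mul]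
  obtain ⟨F, hF, hFe⟩ := exists_eq_pow_succ_mul_of_isLittleO he ho
  refine ⟨fun t => fderiv ℂ G (γ t₀) (δ t) + (t - t₀) * F t,
    hd.add ((analyticAt_id.sub analyticAt_const).fun_mul hF), by simp, ?_⟩
  filter_upwards [hFe] with t ht
  linear_combination ht

/-- The angle differentials along the branch `g₁ = 0` of a node at which `∂R/∂H_j` vanishes. -/
theorem anglePullbackHolomorphicAt_branch (hl : T.minRank ≤ l)
    {P : Polynomial ℂ} {H : HamIndex T l g → ℂ} (j : HamIndex T l g) {γ : ℂ → ℂ × ℂ × ℂ} {t₀ : ℂ}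
    (hγ : AnalyticAt ℂ γ t₀) (hC : ∀ᶠ t in 𝓝 t₀, γ t ∈ spectralCurve P H)
    (hne : ¬ ∀ᶠ t in 𝓝 t₀, γ t = γ t₀) (hy : (γ t₀).2.1 ≠ 0)
    {g₁ g₂ : ℂ × ℂ × ℂ → ℂ} (hg₁ : AnalyticAt ℂ g₁ (γ t₀)) (hg₂ : AnalyticAt ℂ g₂ (γ t₀))
    (hg₂0 : g₂ (γ t₀) = 0)
    (hR : ∀ᶠ q in 𝓝 (γ t₀), baseEq P q = 0 → spectralR H q = g₁ q * g₂ q)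
    (hker : ∀ v, fderiv ℂ (baseEq P) (γ t₀) v = 0 → fderiv ℂ g₁ (γ t₀) v = 0 →
      fderiv ℂ g₂ (γ t₀) v = 0 → v = 0)
    (hsub : fderiv ℂ g₁ (γ t₀) (horizontalVector P (γ t₀)) ≠ 0 ∨
      fderiv ℂ g₁ (γ t₀) verticalVector ≠ 0)
    (hh0 : dRdH H j (γ t₀) = 0) (hbranch : ∀ᶠ t in 𝓝 t₀, g₁ (γ t) = 0) :
    AnglePullbackHolomorphicAt H j γ t₀ := by
  have hB : ∀ᶠ t in 𝓝 t₀, baseEq P (γ t) = 0 := hC.mono fun t ht => ht.1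
  have hay := (analyticAt_coords hγ).2.1
  have hx := mt (eventually_eq_of_eventually_deriv_fst_eq_zero hl P H hγ hC) hne
  obtain ⟨f, hf, hf1, hf2⟩ := exists_deriv_fst_eq_mul P hγ hB hy hg₁ hbranch hsub hx
  obtain ⟨k, v, hv, hlead⟩ := exists_leading_direction hγ hne
  have hvanish : ∀ G : ℂ × ℂ × ℂ → ℂ, AnalyticAt ℂ G (γ t₀) → (∀ᶠ t in 𝓝 t₀, G (γ t) = 0) →
      fderiv ℂ G (γ t₀) v = 0 := by
    intro G hG hG0
    obtain ⟨F, hF, hF0, hFe⟩ := hlead G hG hG0.self_of_nhds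
    rw [← hF0]
    refine (hF.frequently_zero_iff_eventually_zero.mp (Filter.Eventually.frequently ?_)).self_of_nhds
    filter_upwards [hFe.filter_mono nhdsWithin_le_nhds, hG0.filter_mono nhdsWithin_le_nhds,
      self_mem_nhdsWithin] with t h1 h2 h3
    rw [h2] at h1
    exact (mul_eq_zero.mp h1.symm).resolve_left (pow_ne_zero _ (sub_ne_zero.mpr h3))
  obtain ⟨F₂, hF₂, hF₂0, hF₂e⟩ := hlead g₂ hg₂ hg₂0
  -- The leading direction is killed by `d(y² - P)` and `dg₁`, so by independence not by `dg₂`: `g₂`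
  -- has order exactly `k` along the branch, while `∂R/∂H_j` has order at least `k`.
  have hF₂ne : F₂ t₀ ≠ 0 := by
    rw [hF₂0]
    exact fun h0 => hv (hker v (hvanish _ (analyticAt_baseEq P _) hB)
      (hvanish _ hg₁ hbranch) h0)
  obtain ⟨Fh, hFh, -, hFhe⟩ := hlead _ ((spectralR_update_eq_dRdH H j).1 _) hh0
  have hprod : ∀ᶠ t in 𝓝 t₀, dRdLambda H (γ t) = fderiv ℂ g₁ (γ t) verticalVector * g₂ (γ t) := by
    filter_upwards [hB, hbranch, hγ.continuousAt.eventually hR.eventually_nhds,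
      hγ.continuousAt.eventually hg₁.eventually_analyticAt,
      hγ.continuousAt.eventually hg₂.eventually_analyticAt] with t h1 h2 h3 h4 h5
    have h6 := fderiv_verticalVector_eq_of_eqOn_surface P
      (analyticAt_spectralR H (γ t)).differentiableAt
      (h4.differentiableAt.fun_mul h5.differentiableAt) h3 h1
    rw [dRdLambda_eq_fderiv, ← verticalVector, h6,
      fderiv_fun_mul h4.differentiableAt h5.differentiableAt]
    simp [h2, mul_comm]
  refine ⟨fun t => Fh t / F₂ t * (f t / (γ t).2.1),
    (hFh.fun_div hF₂ hF₂ne).fun_mul (hf.fun_div hay hy), ?_⟩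
  filter_upwards [hf1, hf2.filter_mono nhdsWithin_le_nhds,
    (hay.continuousAt.eventually_ne hy).filter_mono nhdsWithin_le_nhds,
    hF₂e.filter_mono nhdsWithin_le_nhds, hFhe.filter_mono nhdsWithin_le_nhds,
    hprod.filter_mono nhdsWithin_le_nhds, self_mem_nhdsWithin,
    (hF₂.continuousAt.eventually_ne hF₂ne).filter_mono nhdsWithin_le_nhds]
    with t h1 h2 h3 h4 h5 h6 h7 h8
  have h9 : (t - t₀) ^ k ≠ 0 := pow_ne_zero _ (sub_ne_zero.mpr h7)
  rw [h6, h4, h5, h2]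
  refine ⟨h3, mul_ne_zero h1 (mul_ne_zero h9 h8), ?_⟩
  field_simp

/-- Angle differentials pull back to holomorphic ones along nonconstant holomorphic maps to the
curve, where these pass through nodes at which `∂R/∂H_j` vanishes. -/
theorem anglePullbackHolomorphicAt_of_isNode (hl : T.minRank ≤ l)
    {P : Polynomial ℂ} {H : HamIndex T l g → ℂ} (j : HamIndex T l g) {γ : ℂ → ℂ × ℂ × ℂ} {t₀ : ℂ}
    (hγ : AnalyticAt ℂ γ t₀) (hC : ∀ᶠ t in 𝓝 t₀, γ t ∈ spectralCurve P H)
    (hne : ¬ ∀ᶠ t in 𝓝 t₀, γ t = γ t₀) (hy : (γ t₀).2.1 ≠ 0) (hnode : IsNode P H (γ t₀))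
    (hh0 : dRdH H j (γ t₀) = 0) : AnglePullbackHolomorphicAt H j γ t₀ := by
  obtain ⟨-, g₁, g₂, hg₁, hg₂, hg₁0, hg₂0, hR, hind⟩ := hnode
  have hdet := jacobian_ne_zero_of_linearIndependent P hy hind
  have hR' : ∀ᶠ q in 𝓝 (γ t₀), baseEq P q = 0 → spectralR H q = g₂ q * g₁ q :=
    hR.mono fun q hq hb => by rw [hq hb, mul_comm]
  have hsub₁ : fderiv ℂ g₁ (γ t₀) (horizontalVector P (γ t₀)) ≠ 0 ∨
      fderiv ℂ g₁ (γ t₀) verticalVector ≠ 0 := by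
    by_contra! h
    simp [h] at hdet
  have hsub₂ : fderiv ℂ g₂ (γ t₀) (horizontalVector P (γ t₀)) ≠ 0 ∨
      fderiv ℂ g₂ (γ t₀) verticalVector ≠ 0 := by
    by_contra! h
    simp [h] at hdet
  have hprod : ∀ᶠ t in 𝓝 t₀, g₁ (γ t) * g₂ (γ t) = 0 := by
    filter_upwards [hC, hγ.continuousAt.eventually hR] with t h1 h2
    rw [← h2 h1.1, h1.2]
  -- By the identity principle one of the two factors vanishes identically along `γ`, which
  -- therefore stays in one branch.
  rcases (hg₁.comp hγ).eventually_eq_zero_or_eventually_ne_zero with h1 | h1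
  · exact anglePullbackHolomorphicAt_branch hl j hγ hC hne hy hg₁ hg₂ hg₂0 hR
      (fun v => eq_zero_of_linearIndependent hind) hsub₁ hh0 h1
  · have h2 : ∀ᶠ t in 𝓝 t₀, g₂ (γ t) = 0 := by
      refine (hg₂.comp hγ).frequently_zero_iff_eventually_zero.mp (Filter.Eventually.frequently ?_)
      filter_upwards [h1, hprod.filter_mono nhdsWithin_le_nhds] with t h3 h4
      exact (mul_eq_zero.mp h4).resolve_left h3
    exact anglePullbackHolomorphicAt_branch hl j hγ hC hne hy hg₂ hg₁ hg₁0 hR'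
      (fun v a b c => eq_zero_of_linearIndependent hind a c b) hsub₂ hh0 h2

/-! ### Persistent nodes -/

/-- At a singular point with `y ≠ 0` the derivatives of `R` along the surface vanish. -/
theorem fderiv_spectralR_eq_zero_of_mem_singularLocus {P : Polynomial ℂ} {H : HamIndex T l g → ℂ}
    {q : ℂ × ℂ × ℂ} (hq : q ∈ singularLocus P H) (hy : q.2.1 ≠ 0) :
    fderiv ℂ (spectralR H) q (horizontalVector P q) = 0 ∧
      fderiv ℂ (spectralR H) q verticalVector = 0 := by
  have h := hq.2
  rw [LinearIndependent.pair_iff] at h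
  push Not at h
  obtain ⟨a, b, hab, hne⟩ := h
  have hb : b ≠ 0 := by
    intro hb
    have h1 := congrArg (fun L => L (0, 1, 0)) hab
    simp only [hb, add_apply, zero_mul, add_zero, smul_apply, fderiv_baseEq_apply,
      zero_apply, smul_eq_mul, mul_one, mul_zero, sub_zero] at h1
    exact hne ((mul_eq_zero.mp h1).resolve_right (mul_ne_zero two_ne_zero hy)) hb
  have hv : ∀ v, fderiv ℂ (baseEq P) q v = 0 → fderiv ℂ (spectralR H) q v = 0 := by
    intro v hv
    have h1 := congrArg (fun L => L v) hab
    simp only [add_apply, smul_apply, hv, zero_apply, smul_eq_mul, mul_zero,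
      zero_add] at h1
    exact (mul_eq_zero.mp h1).resolve_left hb
  exact ⟨hv _ (fderiv_baseEq_horizontalVector P hy), hv _ (fderiv_baseEq_verticalVector P q)⟩

open Classical in
/-- `∂R/∂H_j` vanishes at a node which persists under deformations of the Hamiltonians. -/
theorem dRdH_eq_zero_of_singularityPersists {P : Polynomial ℂ} {H : HamIndex T l g → ℂ}
    (j : HamIndex T l g) {p : ℂ × ℂ × ℂ} (hy : p.2.1 ≠ 0) (hnode : IsNode P H p)
    (hpers : SingularityPersists P H p) : dRdH H j p = 0 := by
  obtain ⟨-, g₁, g₂, hg₁, hg₂, hg₁0, hg₂0, hR, hind⟩ := hnode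
  have hdet := jacobian_ne_zero_of_linearIndependent P hy hind
  obtain ⟨hh, h', hh', hupd⟩ := spectralR_update_eq_dRdH H j
  by_contra hne
  have hX := (analyticAt_horizontalVector P hy).continuousAt
  have cont : ∀ G : ℂ × ℂ × ℂ → ℂ, AnalyticAt ℂ G p →
      ContinuousAt (fun q => fderiv ℂ G q (horizontalVector P q)) p ∧
      ContinuousAt (fun q => fderiv ℂ G q verticalVector) p := fun G hG =>
    ⟨hG.fderiv.continuousAt.clm_apply hX, hG.fderiv.continuousAt.clm_apply continuousAt_const⟩
  obtain ⟨ca₁, cb₁⟩ := cont g₁ hg₁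
  obtain ⟨ca₂, cb₂⟩ := cont g₂ hg₂
  obtain ⟨cah, cbh⟩ := cont _ (hh p)
  obtain ⟨cah', cbh'⟩ := cont _ (hh' p)
  set a₁ := fun q => fderiv ℂ g₁ q (horizontalVector P q)
  set a₂ := fun q => fderiv ℂ g₂ q (horizontalVector P q)
  set b₁ := fun q => fderiv ℂ g₁ q verticalVector
  set b₂ := fun q => fderiv ℂ g₂ q verticalVector
  set u := fun q => fderiv ℂ (dRdH H j) q (horizontalVector P q)
  set w := fun q => fderiv ℂ (dRdH H j) q verticalVector
  set u' := fun q => fderiv ℂ h' q (horizontalVector P q)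
  set w' := fun q => fderiv ℂ h' q verticalVector
  let D := fun q => a₂ q * b₁ q - a₁ q * b₂ q
  let K₁ := fun z : (ℂ × ℂ × ℂ) × ℂ =>
    -(u z.1 + z.2 * u' z.1) * b₁ z.1 + (w z.1 + z.2 * w' z.1) * a₁ z.1
  let K₂ := fun z : (ℂ × ℂ × ℂ) × ℂ =>
    -(w z.1 + z.2 * w' z.1) * a₂ z.1 + (u z.1 + z.2 * u' z.1) * b₂ z.1
  -- `Φ` is what remains of `D²` times the deformed equation after substituting `D g₁ = s K₁`, `D g₂
  -- = s K₂` and dividing by `s`. At `(p, 0)` it equals `D² ∂R/∂H_j`, with `D ≠ 0` there by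
  -- transversality of the branches.
  let Φ := fun z : (ℂ × ℂ × ℂ) × ℂ => D z.1 ^ 2 * dRdH H j z.1 +
    z.2 * (K₁ z * K₂ z + D z.1 ^ 2 * h' z.1)
  have hΦ : ContinuousAt Φ (p, 0) := by
    have lift : ∀ F : ℂ × ℂ × ℂ → ℂ, ContinuousAt F p →
        ContinuousAt (fun z : (ℂ × ℂ × ℂ) × ℂ => F z.1) (p, 0) := fun F hF =>
      ContinuousAt.comp (f := Prod.fst) (g := F) hF continuousAt_fst
    have l₁ := lift _ ca₁
    have l₂ := lift _ ca₂
    have l₃ := lift _ cb₁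
    have l₄ := lift _ cb₂
    have l₅ := lift _ cah
    have l₆ := lift _ cbh
    have l₇ := lift _ cah'
    have l₈ := lift _ cbh'
    have l₉ := lift _ (hh p).continuousAt
    have l₀ := lift _ (hh' p).continuousAt
    simp only [Φ, K₁, K₂, D]
    fun_prop
  have hΦ0 : Φ (p, 0) ≠ 0 := by
    simp only [Φ, zero_mul, add_zero]
    exact mul_ne_zero (pow_ne_zero _ hdet) hne
  have hev := hΦ.eventually_ne hΦ0
  rw [nhds_prod_eq] at hev
  obtain ⟨pU, hpU, pS, hpS, hUS⟩ := Filter.eventually_prod_iff.mp hev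
  have hy' : ∀ᶠ q in 𝓝 p, q.2.1 ≠ 0 := (analyticAt_snd_fst p).continuousAt.eventually_ne hy
  have hgood := hpU.and (hy'.and (hR.eventually_nhds.and
    (hg₁.eventually_analyticAt.and hg₂.eventually_analyticAt)))
  have hcont : Filter.Tendsto (fun s : ℂ => Function.update H j (H j + s)) (𝓝 0) (𝓝 H) := by
    have : Continuous fun s : ℂ => Function.update H j (H j + s) :=
      continuous_const.update j (by fun_prop)
    simpa using this.tendsto 0
  have hs := (((hcont.eventually (hpers _ hgood)).and hpS).filter_mono
    (nhdsWithin_le_nhds (s := {0}ᶜ))).and self_mem_nhdsWithin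
  -- Choose `s ≠ 0` so small that the deformed curve has a singular point `q` near `p` and `Φ (q, s)
  -- ≠ 0`; the contradiction is `s * Φ (q, s) = 0`.
  obtain ⟨s, ⟨⟨q, ⟨hqU, hqy, hqR, hq₁, hq₂⟩, hqs⟩, hsS⟩, hs0⟩ := hs.exists
  have hs0 : s ≠ 0 := hs0
  refine hUS hqU hsS ?_
  have hqB : baseEq P q = 0 := hqs.1.1
  have hfun : spectralR (Function.update H j (H j + s)) =
      fun q => spectralR H q + s * dRdH H j q + s ^ 2 * h' q := funext fun q => hupd s q
  have hder : ∀ v, fderiv ℂ (spectralR (Function.update H j (H j + s))) q v =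
      fderiv ℂ (spectralR H) q v + s * fderiv ℂ (dRdH H j) q v + s ^ 2 * fderiv ℂ h' q v := by
    intro v
    rw [hfun]
    have e := (((analyticAt_spectralR H q).differentiableAt.hasFDerivAt.fun_add
      ((hh q).differentiableAt.hasFDerivAt.const_mul s)).fun_add
      ((hh' q).differentiableAt.hasFDerivAt.const_mul (s ^ 2))).fderiv
    rw [e]
    simp
  have hmul : ∀ v, fderiv ℂ (fun r => g₁ r * g₂ r) q v =
      g₁ q * fderiv ℂ g₂ q v + g₂ q * fderiv ℂ g₁ q v := by
    intro v
    rw [fderiv_fun_mul hq₁.differentiableAt hq₂.differentiableAt]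
    simp
  have hdiff := hq₁.differentiableAt.fun_mul hq₂.differentiableAt
  obtain ⟨z₁, z₂⟩ := fderiv_spectralR_eq_zero_of_mem_singularLocus hqs hqy
  rw [hder, fderiv_horizontalVector_eq_of_eqOn_surface P
    (analyticAt_spectralR H q).differentiableAt hdiff hqR hqB hqy, hmul] at z₁
  rw [hder, fderiv_verticalVector_eq_of_eqOn_surface P
    (analyticAt_spectralR H q).differentiableAt hdiff hqR hqB, hmul] at z₂
  have z₃ : g₁ q * g₂ q + s * dRdH H j q + s ^ 2 * h' q = 0 := by
    rw [← hqR.self_of_nhds hqB, ← hupd]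
    exact hqs.1.2
  change g₁ q * a₂ q + g₂ q * a₁ q + s * u q + s ^ 2 * u' q = 0 at z₁
  change g₁ q * b₂ q + g₂ q * b₁ q + s * w q + s ^ 2 * w' q = 0 at z₂
  -- Cramer's rule for `g₁ q`, `g₂ q` in the two derivative equations `z₁`, `z₂`.
  have e₁ : g₁ q * D q = s * K₁ (q, s) := by
    simp only [D, K₁]
    linear_combination b₁ q * z₁ - a₁ q * z₂
  have e₂ : g₂ q * D q = s * K₂ (q, s) := by
    simp only [D, K₂]
    linear_combination a₂ q * z₂ - b₂ q * z₁
  have e₃ : s * Φ (q, s) = 0 := by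
    simp only [Φ]
    linear_combination D q ^ 2 * z₃ - g₂ q * D q * e₁ - s * K₁ (q, s) * e₂
  exact (mul_eq_zero.mp e₃).resolve_left hs0

/-! ### Charts of the normalization and the theorem -/

theorem IsNormalization.analyticAt_chart {M : Type*} [TopologicalSpace M] [ChartedSpace ℂ M]
    {C S : Set (ℂ × ℂ × ℂ)} {ν : M → ℂ × ℂ × ℂ} (hν : IsNormalization C S ν) (m : M) :
    AnalyticAt ℂ (fun t => ν ((chartAt ℂ m).symm t)) (chartAt ℂ m m) := by
  have h := (hν.holomorphic m).2
  simp only [ContDiffWithinAtProp, mfld_simps, contDiffWithinAt_univ] at h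
  exact h.analyticAt

/-- Otherwise a finite fibre would contain the injective image of an infinite neighbourhood in the
chart. -/
theorem IsNormalization.not_eventually_const {M : Type*} [TopologicalSpace M] [ChartedSpace ℂ M]
    {C S : Set (ℂ × ℂ × ℂ)} {ν : M → ℂ × ℂ × ℂ} (hν : IsNormalization C S ν) (m : M) :
    ¬ ∀ᶠ t in 𝓝 (chartAt ℂ m m),
      ν ((chartAt ℂ m).symm t) = ν ((chartAt ℂ m).symm (chartAt ℂ m m)) := by
  intro h
  set e := chartAt ℂ m
  set c := ν (e.symm (e m))
  have htgt : e.target ∈ 𝓝 (e m) :=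
    e.open_target.mem_nhds (mem_chart_target ℂ m)
  have hset : {t | t ∈ e.target ∧ ν (e.symm t) = c} ∈ 𝓝 (e m) := Filter.inter_mem htgt h
  refine (infinite_of_mem_nhds (e m) hset).mono (fun t ht => ht) |>.elim ?_
  refine Set.Finite.of_finite_image ((hν.finite_fibre c).subset ?_)
    (e.symm.injOn.mono fun t ht => ht.1)
  rintro _ ⟨t, ht, rfl⟩
  exact ht.2

end HitchinHyperelliptic

open HitchinHyperelliptic in
theorem mainTheorem1 (T : ClassicalSeries) (l g : ℕ) (hl : T.minRank ≤ l) (hg : 2 ≤ g)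
    (P : Polynomial ℂ) (hPmonic : P.Monic) (hPdeg : P.natDegree = 2 * g + 1)
    (hPsq : Squarefree P)
    (H : HamIndex T l g → ℂ)
    (hnodes : ∀ p ∈ singularLocus P H, IsNode P H p)
    (havoid : ∀ p ∈ ramificationLocus P H ∪ singularLocus P H, p.2.1 ≠ 0) :
    (∀ p ∈ spectralCurve P H, p ∉ singularLocus P H →
      ∀ j : HamIndex T l g, AngleHolomorphicAt P H j p) ∧
    ((∀ p ∈ singularLocus P H, SingularityPersists P H p) →
      ∀ (M : Type*) [TopologicalSpace M] [ChartedSpace ℂ M] (ν : M → ℂ × ℂ × ℂ),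
        IsNormalization (spectralCurve P H) (singularLocus P H) ν →
        ∀ (j : HamIndex T l g) (m : M),
          AnglePullbackHolomorphicAt H j (fun t => ν ((chartAt ℂ m).symm t)) (chartAt ℂ m m)) := by
  have hram : ∀ p ∈ ramificationLocus P H, p.2.1 ≠ 0 := fun p hp => havoid p (.inl hp)
  refine ⟨fun p hp hps j γ hγ => ?_, fun hpers M _ _ ν hν j m => ?_⟩
  · obtain ⟨han, rfl, hder, hC⟩ := hγ
    refine anglePullbackHolomorphicAt_of_notMem_singularLocus hl hPsq hram j han hC (fun h => ?_) hps
    exact hder ((Filter.EventuallyEq.deriv_eq h).trans (deriv_const _ _))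
  · have han := hν.analyticAt_chart m
    have hne := hν.not_eventually_const m
    have hC : ∀ t, ν ((chartAt ℂ m).symm t) ∈ spectralCurve P H :=
      fun t => hν.range_eq ▸ Set.mem_range_self _
    by_cases hs : ν ((chartAt ℂ m).symm (chartAt ℂ m m)) ∈ singularLocus P H
    · have hy := havoid _ (.inr hs)
      exact anglePullbackHolomorphicAt_of_isNode hl j han (.of_forall hC) hne hy (hnodes _ hs)
        (dRdH_eq_zero_of_singularityPersists j hy (hnodes _ hs) (hpers _ hs))
    · exact anglePullbackHolomorphicAt_of_notMem_singularLocus hl hPsq hram j han (.of_forall hC)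
        hne hs
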